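/- Let $L/K$ be a finite Galois extension of nonarchimedean local fields with Galois group $G=\mathrm{Gal}(L/K)$, let $I_G$ be the kernel of the augmentation $\mathbb Z[G]\to\mathbb Z$, and write $H_T^r$ for Tate cohomology. Let $\varphi:G\times G\to L^\times$ be a $2$-cocycle whose class $[\varphi]$ generates $H^2(G,L^\times)$. Let $L^\times(\varphi)=L^\times\oplus\bigoplus_{\sigma\in G,\,\sigma\neq1}\mathbb Z x_\sigma$ be the splitting module, in which $L^\times$ carries its usual action and $$\sigma\cdot x_\tau=x_{\sigma\tau}-x_\sigma+\varphi(\sigma,\tau),\qquad x_1:=\varphi(1,1)\in L^\times,$$ and let $\alpha:L^\times(\varphi)\to I_G$ be the $G$-homomorphism that is zero on $L^\times$ and sends $x_\sigma$ to $\sigma-1$. Consider the inverse local reciprocity map, obtained as the composition $$G^{\mathrm{ab}}\to H_T^{-2}(G,\mathbb Z)\to H_T^{-1}(G,I_G)\to H_T^0(G,L^\times)=K^\times/\mathrm{Nm}_{L/K}(L^\times),$$ where the second and third maps are the connecting homomorphisms of the exact sequences $0\to I_G\to\mathbb Z[G]\to\mathbb Z\to0$ and $0\to L^\times\to L^\times(\varphi)\xrightarrow{\alpha}I_G\to0$,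 and the first map is the isomorphism $G^{\mathrm{ab}}\to I_G/I_G^2=H_T^{-1}(G,I_G)$, $[\sigma]\mapsto[\sigma-1]$, followed by the inverse of the connecting isomorphism $H_T^{-2}(G,\mathbb Z)\to H_T^{-1}(G,I_G)$. Then for every $\sigma\in G$ the product $\prod_{\tau\in G}\varphi(\tau,\sigma)$ lies in $K^\times$, and this map is given by $$[\sigma]\mapsto\Bigl[\prod_{\tau\in G}\varphi(\tau,\sigma)\Bigr].$$ -/

import Mathlib

namespace LocalRec

open CategoryTheory

noncomputable section

variable {k : Type} [CommRing k]

section Homology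

variable (C : CochainComplex (ModuleCat.{0} k) ℤ) {m n p : ℤ}

/-- The cohomology class of a cocycle `x`. -/
def homologyClass (hp : n + 1 = p) (x : C.X n) (hx : C.d n p x = 0) : C.homology n :=
  C.homologyπ n (C.cyclesMk x p (by subst hp; simp) hx)

variable {C}

theorem iCycles_cyclesMk (x : C.X n) (h) (hx) :
    C.iCycles n (C.cyclesMk x p h hx) = x :=
  C.i_cyclesMk x p h hx

theorem iCycles_injective : Function.Injective (C.iCycles n) :=
  (ModuleCat.mono_iff_injective _).1 inferInstance

theorem homologyClass_surjective (hp : n + 1 = p) (y : C.homology n) :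
    ∃ x hx, homologyClass C hp x hx = y := by
  obtain ⟨z, rfl⟩ := (ModuleCat.epi_iff_surjective (C.homologyπ n)).1 inferInstance y
  have hz : C.d n p (C.iCycles n z) = 0 := by
    rw [← ConcreteCategory.comp_apply, C.iCycles_d]; rfl
  refine ⟨C.iCycles n z, hz, ?_⟩
  exact congrArg (C.homologyπ n) (iCycles_injective (iCycles_cyclesMk _ _ hz))

theorem homologyClass_add (hp : n + 1 = p) (x y : C.X n) (hx hy hxy) :
    homologyClass C hp (x + y) hxy = homologyClass C hp x hx + homologyClass C hp y hy := by
  unfold homologyClass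
  refine Eq.trans (congrArg (C.homologyπ n) ?_) (map_add (C.homologyπ n).hom _ _)
  apply iCycles_injective
  refine (iCycles_cyclesMk _ _ hxy).trans (Eq.trans ?_ (map_add (C.iCycles n).hom _ _).symm)
  exact congrArg₂ _ (iCycles_cyclesMk _ _ hx).symm (iCycles_cyclesMk _ _ hy).symm

theorem homologyClass_eq_zero_iff (hm : m + 1 = n) (hp : n + 1 = p) (x : C.X n) (hx) :
    homologyClass C hp x hx = 0 ↔ ∃ y : C.X m, C.d m n y = x := by
  have hm' : (ComplexShape.up ℤ).prev n = m := by subst hm; simp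
  have hex := ShortComplex.exact_of_g_is_cokernel
    (ShortComplex.mk _ _ (C.toCycles_comp_homologyπ m n)) (C.homologyIsCokernel m n hm')
  constructor
  · intro h
    obtain ⟨y, hy⟩ := (ShortComplex.moduleCat_exact_iff _).1 hex _ h
    refine ⟨y, ?_⟩
    have := congrArg (C.iCycles n) hy
    refine Eq.trans ?_ (this.trans (iCycles_cyclesMk _ _ hx))
    change _ = (C.toCycles m n ≫ C.iCycles n) y
    rw [C.toCycles_i]
  · rintro ⟨y, rfl⟩
    have : C.cyclesMk (C.d m n y) p (by subst hp; simp) hx = C.toCycles m n y := by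
      apply iCycles_injective
      refine (iCycles_cyclesMk _ _ hx).trans ?_
      change _ = (C.toCycles m n ≫ C.iCycles n) y
      rw [C.toCycles_i]
    refine (congrArg (C.homologyπ n) this).trans ?_
    change (C.toCycles m n ≫ C.homologyπ n) y = 0
    rw [C.toCycles_comp_homologyπ]; rfl

variable {N₁ N₂ N₃ : ModuleCat.{0} k} {e₁ : C.X m ≅ N₁} {e₂ : C.X n ≅ N₂} {e₃ : C.X p ≅ N₃}
  {d₁ : N₁ ⟶ N₂} {d₂ : N₂ ⟶ N₃}

theorem d_inv_apply (h₂ : C.d n p ≫ e₃.hom = e₂.hom ≫ d₂) (a : N₂) :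
    C.d n p (e₂.inv a) = e₃.inv (d₂ a) := by
  have : e₂.inv ≫ C.d n p = d₂ ≫ e₃.inv := by
    rw [Iso.inv_comp_eq, ← Category.assoc, Iso.eq_comp_inv, h₂]
  exact congr($this a)

variable (e₂) in
/-- The cohomology class of `a : N₂` with `d₂ a = 0`, where `N₂`, `N₃` are modules isomorphic to two
consecutive terms of the complex and `d₂` corresponds to the differential. -/
def isoClass (hp : n + 1 = p) (h₂ : C.d n p ≫ e₃.hom = e₂.hom ≫ d₂) (a : N₂) (ha : d₂ a = 0) :
    C.homology n :=
  homologyClass C hp (e₂.inv a) (by rw [d_inv_apply h₂, ha, map_zero])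

theorem isoClass_add (hp : n + 1 = p) (h₂ : C.d n p ≫ e₃.hom = e₂.hom ≫ d₂) (a b : N₂)
    (ha hb hab) :
    isoClass e₂ hp h₂ (a + b) hab = isoClass e₂ hp h₂ a ha + isoClass e₂ hp h₂ b hb := by
  unfold isoClass
  rw [← homologyClass_add]
  · congr 1
    exact map_add e₂.inv.hom a b
  · rw [map_add, d_inv_apply h₂, ha, d_inv_apply h₂, hb, map_zero, add_zero]

theorem isoClass_surjective (hp : n + 1 = p) (h₂ : C.d n p ≫ e₃.hom = e₂.hom ≫ d₂)
    (y : C.homology n) : ∃ a ha, isoClass e₂ hp h₂ a ha = y := by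
  obtain ⟨x, hx, rfl⟩ := homologyClass_surjective hp y
  have ha : d₂ (e₂.hom x) = 0 := by
    have : (e₂.hom ≫ d₂) x = 0 := by
      rw [← h₂, ConcreteCategory.comp_apply, hx, map_zero]
    exact this
  refine ⟨e₂.hom x, ha, ?_⟩
  unfold isoClass
  congr 1
  simp

theorem isoClass_eq_zero_iff (hm : m + 1 = n) (hp : n + 1 = p)
    (h₁ : C.d m n ≫ e₂.hom = e₁.hom ≫ d₁) (h₂ : C.d n p ≫ e₃.hom = e₂.hom ≫ d₂) (a : N₂) (ha) :
    isoClass e₂ hp h₂ a ha = 0 ↔ ∃ b, d₁ b = a := by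
  refine (homologyClass_eq_zero_iff hm hp _ _).trans ⟨?_, ?_⟩
  · rintro ⟨y, hy⟩
    refine ⟨e₁.hom y, ?_⟩
    have : (e₁.hom ≫ d₁) y = a := by
      rw [← h₁, ConcreteCategory.comp_apply, hy]; simp
    exact this
  · rintro ⟨b, rfl⟩
    exact ⟨e₁.inv b, d_inv_apply h₁ b⟩

theorem isZero_homology (hm : m + 1 = n) (hp : n + 1 = p)
    (h₁ : C.d m n ≫ e₂.hom = e₁.hom ≫ d₁) (h₂ : C.d n p ≫ e₃.hom = e₂.hom ≫ d₂)
    (h : ∀ x : N₂, d₂ x = 0 → ∃ y : N₁, d₁ y = x) : Limits.IsZero (C.homology n) := by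
  have : Subsingleton (C.homology n) := by
    refine subsingleton_of_forall_eq 0 fun y => ?_
    obtain ⟨x, hx, rfl⟩ := isoClass_surjective hp h₂ y
    exact (isoClass_eq_zero_iff hm hp h₁ h₂ x hx).2 (h x hx)
  exact ModuleCat.isZero_of_subsingleton _

end Homology

variable {G : Type} [Group G]

section Tate

variable [Fintype G] (M : Rep k G)

def tateIsoNegThree : (tateComplex M).X (-3) ≅ ModuleCat.of k (G × G →₀ M) :=
  groupHomology.chainsIso₂ M

def tateIsoNegTwo : (tateComplex M).X (-2) ≅ ModuleCat.of k (G →₀ M) :=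
  groupHomology.chainsIso₁ M

def tateIsoNegOne : (tateComplex M).X (-1) ≅ ModuleCat.of k M :=
  groupHomology.chainsIso₀ M

def tateIsoZero : (tateComplex M).X 0 ≅ ModuleCat.of k M :=
  groupCohomology.cochainsIso₀ M

def tateIsoOne : (tateComplex M).X 1 ≅ ModuleCat.of k (G → M) :=
  groupCohomology.cochainsIso₁ M

theorem tate_d_neg_three : (tateComplex M).d (-3) (-2) ≫ (tateIsoNegTwo M).hom =
    (tateIsoNegThree M).hom ≫ groupHomology.d₂₁ M :=
  (groupHomology.comp_d₂₁_eq M).symm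

theorem tate_d_neg_two : (tateComplex M).d (-2) (-1) ≫ (tateIsoNegOne M).hom =
    (tateIsoNegTwo M).hom ≫ groupHomology.d₁₀ M :=
  (groupHomology.comp_d₁₀_eq M).symm

theorem tate_d_neg_one : (tateComplex M).d (-1) 0 ≫ (tateIsoZero M).hom =
    (tateIsoNegOne M).hom ≫ M.norm.toModuleCatHom := by
  have : (tateComplex M).d (-1) 0 =
      (tateIsoNegOne M).hom ≫ M.norm.toModuleCatHom ≫ (tateIsoZero M).inv := rfl
  rw [this]; simp

theorem tate_d_zero : (tateComplex M).d 0 1 ≫ (tateIsoOne M).hom =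
    (tateIsoZero M).hom ≫ groupCohomology.d₀₁ M :=
  (groupCohomology.comp_d₀₁_eq M).symm

/-- The class in `H_T^{-1}(G, M) = ker Nm_G / I_G M` of an element of `ker Nm_G`. -/
def tateNegOneClass (a : M) (ha : M.ρ.norm a = 0) : tateCohomology M (-1) :=
  isoClass (tateIsoNegOne M) (by norm_num) (tate_d_neg_one M) a ha

/-- The class in `H_T^0(G, M) = M^G / Nm_G M` of an element of `M^G`. -/
def tateZeroClass (a : M) (ha : a ∈ M.ρ.invariants) : tateCohomology M 0 :=
  isoClass (tateIsoZero M) (by norm_num) (tate_d_zero M) a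
    (by rwa [← groupCohomology.d₀₁_ker_eq_invariants] at ha)

variable {M}

theorem tateNegOneClass_add (a b : M) (ha hb hab) :
    tateNegOneClass M (a + b) hab = tateNegOneClass M a ha + tateNegOneClass M b hb :=
  isoClass_add ..

theorem tateZeroClass_add (a b : M) (ha hb hab) :
    tateZeroClass M (a + b) hab = tateZeroClass M a ha + tateZeroClass M b hb :=
  isoClass_add ..

theorem tateNegOneClass_surjective (y : tateCohomology M (-1)) :
    ∃ a ha, tateNegOneClass M a ha = y :=
  isoClass_surjective (C := tateComplex M) (by norm_num) (tate_d_neg_one M) y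

theorem tateZeroClass_surjective (y : tateCohomology M 0) :
    ∃ a ha, tateZeroClass M a ha = y := by
  obtain ⟨a, ha, h⟩ := isoClass_surjective (C := tateComplex M) (by norm_num) (tate_d_zero M) y
  exact ⟨a, by rwa [← groupCohomology.d₀₁_ker_eq_invariants], h⟩

theorem tateZeroClass_eq_zero_iff (a : M) (ha) :
    tateZeroClass M a ha = 0 ↔ ∃ b, M.ρ.norm b = a :=
  isoClass_eq_zero_iff (by norm_num) (by norm_num) (tate_d_neg_one M) ..

theorem tateNegOneClass_eq_zero_iff (a : M) (ha) :
    tateNegOneClass M a ha = 0 ↔ a ∈ Representation.Coinvariants.ker M.ρ := by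
  rw [← groupHomology.range_d₁₀_eq_coinvariantsKer]
  exact isoClass_eq_zero_iff (by norm_num) (by norm_num) (tate_d_neg_two M) ..

end Tate

theorem shortExact_of_apply {S : ShortComplex (Rep.{0, 0, 0} k G)} (hf : Function.Injective S.f.hom)
    (hg : Function.Surjective S.g.hom) (h : ∀ x, S.g.hom x = 0 → ∃ y, S.f.hom y = x) :
    S.ShortExact where
  exact := by
    rw [← ShortComplex.exact_map_iff_of_faithful S (forget₂ (Rep k G) (ModuleCat k)),
      ShortComplex.moduleCat_exact_iff]
    exact h
  mono_f := (Rep.mono_iff_injective _).2 hf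
  epi_g := (Rep.epi_iff_surjective _).2 hg

section Augmentation

variable (k G)

/-- The augmentation `k[G] ⟶ k`, `∑ n_g g ↦ ∑ n_g`. -/
def augmentation : Rep.leftRegular k G ⟶ Rep.trivial k G k :=
  Rep.leftRegularHom (Rep.trivial k G k) (1 : k)

/-- The augmentation ideal `I_G`, as a subrepresentation of `k[G]`. -/
def augIdeal : Rep.{0, 0, 0} k G :=
  Rep.subrepresentation (Rep.leftRegular k G) (LinearMap.ker (augmentation k G).hom.toLinearMap)
    (fun g x hx => by
      have := Rep.hom_comm_apply (augmentation k G) g x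
      exact this.trans hx)

/-- The exact sequence `0 ⟶ I_G ⟶ k[G] ⟶ k ⟶ 0`. -/
def augSeq : ShortComplex (Rep.{0, 0, 0} k G) where
  X₁ := augIdeal k G
  X₂ := Rep.leftRegular k G
  X₃ := Rep.trivial k G k
  f := Rep.subtype _ _ _
  g := augmentation k G
  zero := by
    ext x
    exact x.2

variable {k G}

theorem augmentation_single (g : G) (r : k) :
    (augmentation k G).hom (MonoidAlgebra.single g r) = r := by
  rw [augmentation, Rep.leftRegularHom_hom_single]
  simp

theorem augSeq_shortExact : (augSeq k G).ShortExact :=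
  shortExact_of_apply Subtype.val_injective
    (fun r : k => ⟨MonoidAlgebra.single (1 : G) r, augmentation_single 1 r⟩) fun x hx => ⟨⟨x, hx⟩, rfl⟩

theorem leftRegular_ρ_single (g h : G) (r : k) :
    (Rep.leftRegular k G).ρ g (MonoidAlgebra.single h r) = MonoidAlgebra.single (g * h) r :=
  Representation.ofMulAction_single g h r

theorem exists_d₁₀_eq (x : MonoidAlgebra k G) :
    ∃ y, groupHomology.d₁₀ (Rep.leftRegular k G) y =
      x - MonoidAlgebra.single 1 ((augmentation k G).hom x) := by
  induction x using MonoidAlgebra.induction_linear with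
  | zero => exact ⟨0, by simp⟩
  | add x y hx hy =>
    obtain ⟨a, ha⟩ := hx
    obtain ⟨b, hb⟩ := hy
    exact ⟨a + b, by rw [map_add, ha, hb, map_add, MonoidAlgebra.single_add]; abel⟩
  | single g r =>
    refine ⟨Finsupp.single g⁻¹ (MonoidAlgebra.single 1 r), ?_⟩
    rw [groupHomology.d₁₀_single, inv_inv, leftRegular_ρ_single, augmentation_single, mul_one]

theorem exists_d₂₁_eq (x : G →₀ MonoidAlgebra k G)
    (hx : groupHomology.d₁₀ (Rep.leftRegular k G) x = 0) :
    ∃ y, groupHomology.d₂₁ (Rep.leftRegular k G) y = x := by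
  let t : MonoidAlgebra k G →ₗ[k] (G →₀ MonoidAlgebra k G) :=
    Finsupp.lsum k (fun h => Finsupp.lsingle h ∘ₗ MonoidAlgebra.lsingle h) ∘ₗ
      (MonoidAlgebra.coeffLinearEquiv k).toLinearMap
  have ht (h : G) (r : k) : t (MonoidAlgebra.single h r) =
      Finsupp.single h (MonoidAlgebra.single h r) := by
    simp [t]
  have key (x : G →₀ MonoidAlgebra k G) : ∃ y, groupHomology.d₂₁ (Rep.leftRegular k G) y =
      x + t (groupHomology.d₁₀ (Rep.leftRegular k G) x) := by
    induction x using Finsupp.induction_linear with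
    | zero => exact ⟨0, by simp⟩
    | add x y hx hy =>
      obtain ⟨a, ha⟩ := hx
      obtain ⟨b, hb⟩ := hy
      exact ⟨a + b, by rw [map_add, ha, hb, map_add, map_add]; abel⟩
    | single g x =>
      induction x using MonoidAlgebra.induction_linear with
      | zero => exact ⟨0, by simp⟩
      | add x y hx hy =>
        obtain ⟨a, ha⟩ := hx
        obtain ⟨b, hb⟩ := hy
        exact ⟨a + b, by rw [map_add, ha, hb, Finsupp.single_add, map_add, map_add]; abel⟩
      | single h r =>
        refine ⟨Finsupp.single (g, g⁻¹ * h) (MonoidAlgebra.single h r), ?_⟩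
        rw [groupHomology.d₂₁_single, groupHomology.d₁₀_single, leftRegular_ρ_single, map_sub,
          ht, ht, mul_inv_cancel_left]
        abel
  obtain ⟨y, hy⟩ := key x
  exact ⟨y, by rw [hy, hx, map_zero, add_zero]⟩

theorem coeff_norm_leftRegular [Fintype G] (x : MonoidAlgebra k G) (t : G) :
    MonoidAlgebra.coeff ((Rep.leftRegular k G).ρ.norm x) t = (augmentation k G).hom x := by
  classical
  induction x using MonoidAlgebra.induction_linear with
  | zero => simp
  | add x y hx hy => rw [map_add, map_add, MonoidAlgebra.coeff_add, Finsupp.add_apply, hx, hy]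
  | single h r =>
    rw [augmentation_single, Representation.norm, LinearMap.sum_apply]
    have : ∀ g : G, MonoidAlgebra.coeff ((Rep.leftRegular k G).ρ g (MonoidAlgebra.single h r)) t =
        if g = t * h⁻¹ then r else 0 := fun g => by
      rw [leftRegular_ρ_single]
      change Finsupp.single (g * h) r t = _
      rw [Finsupp.single_apply, eq_mul_inv_iff_mul_eq]
    refine Eq.trans ?_ (Finset.sum_ite_eq' Finset.univ (t * h⁻¹) (fun _ => r) |>.trans (by simp))
    rw [MonoidAlgebra.coeff_sum, Finsupp.finsetSum_apply]
    exact Finset.sum_congr rfl fun g _ => this g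

variable (k G)

theorem isZero_leftRegular_neg_two [Fintype G] :
    Limits.IsZero (tateCohomology (Rep.leftRegular k G) (-2)) :=
  isZero_homology (by norm_num) (by norm_num) (tate_d_neg_three _) (tate_d_neg_two _)
    exists_d₂₁_eq

theorem isZero_leftRegular_neg_one [Fintype G] :
    Limits.IsZero (tateCohomology (Rep.leftRegular k G) (-1)) := by
  refine isZero_homology (by norm_num) (by norm_num) (tate_d_neg_two _) (tate_d_neg_one _)
    fun x hx => ?_
  have h : (augmentation k G).hom x = 0 := by
    rw [← coeff_norm_leftRegular x 1]
    exact congrArg (fun y : MonoidAlgebra k G => y.coeff 1) hx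
  obtain ⟨y, hy⟩ := exists_d₁₀_eq (k := k) (G := G) x
  exact ⟨y, by rw [hy, h]; simp⟩

theorem isIso_δ_augSeq [Fintype G] :
    IsIso (TateCohomology.δ (augSeq_shortExact (k := k) (G := G)) (-2)) :=
  ShortComplex.ShortExact.isIso_δ _ _ _ _ (isZero_leftRegular_neg_two k G)
    (isZero_leftRegular_neg_one k G)

/-- The connecting isomorphism `H_T^{-2}(G, k) ≅ H_T^{-1}(G, I_G)`. -/
def tateAugIso [Fintype G] :
    tateCohomology (Rep.trivial k G k) (-2) ≅ tateCohomology (augIdeal k G) (-1) :=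
  @asIso _ _ _ _ (TateCohomology.δ (augSeq_shortExact (k := k) (G := G)) (-2))
    (isIso_δ_augSeq k G)

end Augmentation

section Abelianization

variable (k) in
/-- The element `σ - 1` of `I_G`. -/
def subOne (σ : G) : augIdeal k G :=
  ⟨MonoidAlgebra.single σ 1 - MonoidAlgebra.single 1 1, by
    rw [LinearMap.mem_ker, map_sub]
    refine sub_eq_zero.2 (Eq.trans (augmentation_single (k := k) σ 1) ?_)
    exact (augmentation_single (k := k) (1 : G) 1).symm⟩

theorem subOne_mul (σ τ : G) :
    subOne k (σ * τ) = subOne k σ + (augIdeal k G).ρ σ (subOne k τ) := by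
  apply Subtype.ext
  change _ = (subOne k σ).1 + (Rep.leftRegular k G).ρ σ (subOne k τ).1
  simp only [subOne, map_sub]
  rw [leftRegular_ρ_single, leftRegular_ρ_single, mul_one]
  abel

variable (G) in
/-- The homomorphism `ℤ[G] → G^ab`, `∑ n_g g ↦ ∏ [g] ^ n_g`. -/
def logHom : MonoidAlgebra ℤ G →ₗ[ℤ] Additive (Abelianization G) :=
  Finsupp.linearCombination ℤ (fun g : G => Additive.ofMul (Abelianization.of g)) ∘ₗ
    (MonoidAlgebra.coeffLinearEquiv ℤ).toLinearMap

theorem logHom_single (g : G) (n : ℤ) : logHom G (MonoidAlgebra.single g n) =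
    n • Additive.ofMul (Abelianization.of g) := by
  simp [logHom]

theorem logHom_mul (g : G) (x : MonoidAlgebra ℤ G) :
    logHom G ((Rep.leftRegular ℤ G).ρ g x) =
      (augmentation ℤ G).hom x • Additive.ofMul (Abelianization.of g) + logHom G x := by
  induction x using MonoidAlgebra.induction_linear with
  | zero => simp
  | add x y hx hy =>
    rw [map_add, map_add, map_add, map_add, hx, hy]
    erw [add_smul]
    abel
  | single h r =>
    rw [leftRegular_ρ_single, augmentation_single, logHom_single, logHom_single, map_mul,
      ofMul_mul, smul_add]

variable [Fintype G]

theorem norm_augIdeal (x : augIdeal k G) : (augIdeal k G).ρ.norm x = 0 := by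
  have h : (Rep.leftRegular k G).ρ.norm x.1 = 0 := by
    apply MonoidAlgebra.coeff_injective
    ext t
    rw [coeff_norm_leftRegular]
    exact x.2
  have h' := (congrArg (fun f => f.hom x) (Rep.norm_comm (augSeq k G).f)).symm
  apply Subtype.ext
  exact Eq.trans (by exact h') h

/-- Every element of `I_G` is killed by the norm, and so has a class in `H_T^{-1}(G, I_G)`. -/
def augClass : augIdeal k G →+ tateCohomology (augIdeal k G) (-1) :=
  AddMonoidHom.mk' (fun x => tateNegOneClass _ x (norm_augIdeal x)) fun _ _ =>
    tateNegOneClass_add ..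

theorem augClass_eq_zero_iff (x : augIdeal k G) :
    augClass x = 0 ↔ x ∈ Representation.Coinvariants.ker (augIdeal k G).ρ :=
  tateNegOneClass_eq_zero_iff x (norm_augIdeal x)

theorem augClass_ρ (σ : G) (x : augIdeal k G) :
    augClass ((augIdeal k G).ρ σ x) = augClass x := by
  rw [← sub_eq_zero, ← map_sub, augClass_eq_zero_iff]
  exact (Representation.Coinvariants.mem_ker_of_eq σ x _ rfl)

variable (k G) in
/-- The homomorphism `G^ab → H_T^{-1}(G, I_G) = I_G / I_G²`, `[σ] ↦ [σ - 1]`. -/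
def abToAugHom : Additive (Abelianization G) →+ tateCohomology (augIdeal k G) (-1) :=
  MonoidHom.toAdditiveLeft (Abelianization.lift
    { toFun := fun σ => Multiplicative.ofAdd (augClass (subOne k σ))
      map_one' := by
        have : subOne k (1 : G) = 0 := Subtype.ext (sub_self _)
        rw [this, map_zero]; rfl
      map_mul' := fun σ τ => by
        rw [subOne_mul, map_add, augClass_ρ]; rfl })

theorem abToAugHom_of (σ : G) :
    abToAugHom k G (Additive.ofMul (Abelianization.of σ)) = augClass (subOne k σ) := rfl

theorem abToAugHom_logHom (x : augIdeal ℤ G) :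
    abToAugHom ℤ G (logHom G x.1) = augClass x := by
  have hp (x : MonoidAlgebra ℤ G) :
      (augmentation ℤ G).hom (x - MonoidAlgebra.single 1 ((augmentation ℤ G).hom x)) = 0 := by
    rw [map_sub]
    exact sub_eq_zero.2 (augmentation_single (k := ℤ) (1 : G) _).symm
  let q (x : MonoidAlgebra ℤ G) : augIdeal ℤ G := ⟨_, hp x⟩
  have hq (x) : (q x).1 = x - MonoidAlgebra.single 1 ((augmentation ℤ G).hom x) := rfl
  have key (x : MonoidAlgebra ℤ G) : abToAugHom ℤ G (logHom G x) = augClass (q x) := by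
    induction x using MonoidAlgebra.induction_linear with
    | zero =>
      have : q 0 = 0 := Subtype.ext (by rw [hq, map_zero]; exact (sub_eq_zero.2 (by simp)))
      rw [this, map_zero, map_zero, map_zero]
    | add x y hx hy =>
      have : q (x + y) = q x + q y := Subtype.ext (by
        change _ = (q x).1 + (q y).1
        rw [hq, hq, hq, map_add, MonoidAlgebra.single_add]
        abel)
      rw [this, map_add, map_add, map_add, hx, hy]
    | single g n =>
      have : q (MonoidAlgebra.single g n) = n • subOne ℤ g := Subtype.ext (by
        change _ = n • (MonoidAlgebra.single g 1 - MonoidAlgebra.single 1 1)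
        rw [hq, augmentation_single, smul_sub]
        simp)
      rw [logHom_single, map_zsmul, abToAugHom_of, this]
      exact (map_zsmul augClass n _).symm
  refine (key x.1).trans (congrArg augClass (Subtype.ext ?_))
  have hx : (augmentation ℤ G).hom x.1 = 0 := x.2
  rw [hq, hx]
  simp

theorem abToAugHom_bijective : Function.Bijective (abToAugHom ℤ G) := by
  constructor
  · rw [injective_iff_map_eq_zero]
    intro a ha
    obtain ⟨σ, rfl⟩ : ∃ σ : G, Additive.ofMul (Abelianization.of σ) = a :=
      QuotientGroup.mk_surjective a
    rw [abToAugHom_of, augClass_eq_zero_iff] at ha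
    have hle (z : augIdeal ℤ G)
        (hz : z ∈ Representation.Coinvariants.ker (augIdeal ℤ G).ρ) : logHom G z.1 = 0 := by
      induction hz using Submodule.span_induction with
      | mem z hz =>
        obtain ⟨⟨g, x⟩, rfl⟩ := hz
        have hx : (augmentation ℤ G).hom x.1 = 0 := x.2
        change logHom G ((Rep.leftRegular ℤ G).ρ g x.1 - x.1) = 0
        rw [map_sub, logHom_mul, hx]
        erw [zero_smul]
        simp
      | zero => exact map_zero _
      | add x y _ _ hx hy => exact (map_add (logHom G) x.1 y.1).trans (by rw [hx, hy, add_zero])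
      | smul n x _ hx => exact (map_smul (logHom G) n x.1).trans (by rw [hx, smul_zero])
    have h := hle (subOne ℤ σ) ha
    have hσ : (subOne ℤ σ).1 = MonoidAlgebra.single σ 1 - MonoidAlgebra.single 1 1 := rfl
    rw [hσ] at h
    rw [map_sub, logHom_single, logHom_single, map_one, ofMul_one, smul_zero, sub_zero,
      one_smul] at h
    exact h
  · intro y
    obtain ⟨x, hx, rfl⟩ := tateNegOneClass_surjective y
    exact ⟨_, abToAugHom_logHom x⟩

variable (G) in
/-- The isomorphism `G^ab ≅ H_T^{-1}(G, I_G)`, `[σ] ↦ [σ - 1]`. -/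
def abEquivAug : Additive (Abelianization G) ≃+ tateCohomology (augIdeal ℤ G) (-1) :=
  AddEquiv.ofBijective _ abToAugHom_bijective

variable (G) in
/-- The isomorphism `G^ab ≅ H_T^{-2}(G, ℤ)`: the composite of `G^ab ≅ I_G / I_G² = H_T^{-1}(G, I_G)`
and the inverse of the connecting isomorphism. -/
def abEquivTate :
    Additive (Abelianization G) ≃+ tateCohomology (Rep.trivial ℤ G ℤ) (-2) :=
  (abEquivAug G).trans (tateAugIso ℤ G).toLinearEquiv.symm.toAddEquiv

end Abelianization

section Splitting

open groupCohomology

variable {C : Rep.{0, 0, 0} k G} (φ : cocycles₂ C)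

open Classical in
/-- The element `x_σ` of `C(φ)`, where `x_1 := φ(1, 1)`. -/
def splitGen (σ : G) : C × ({σ : G // σ ≠ 1} →₀ k) :=
  if h : σ = 1 then (φ (1, 1), 0) else (0, Finsupp.single ⟨σ, h⟩ 1)

theorem splitGen_one : splitGen φ 1 = (φ (1, 1), 0) := dif_pos rfl

theorem splitGen_coe (σ : {σ : G // σ ≠ 1}) : splitGen φ σ = (0, Finsupp.single σ 1) :=
  dif_neg σ.2

/-- The action of `σ` on `C(φ)`: the given one on `C`, and
`σ · x_τ = x_{στ} - x_σ + φ(σ, τ)`. -/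
def splitAct (σ : G) :
    (C × ({σ : G // σ ≠ 1} →₀ k)) →ₗ[k] (C × ({σ : G // σ ≠ 1} →₀ k)) :=
  LinearMap.coprod (LinearMap.inl k C ({σ : G // σ ≠ 1} →₀ k) ∘ₗ C.ρ σ)
    (Finsupp.linearCombination k fun τ : {σ : G // σ ≠ 1} =>
      splitGen φ (σ * τ) - splitGen φ σ + (φ (σ, τ), 0))

theorem splitAct_inl (σ : G) (c : C) : splitAct φ σ (c, 0) = (C.ρ σ c, 0) := by
  simp [splitAct]

theorem splitAct_gen (σ τ : G) : splitAct φ σ (splitGen φ τ) =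
    splitGen φ (σ * τ) - splitGen φ σ + (φ (σ, τ), 0) := by
  by_cases h : τ = 1
  · subst h
    rw [splitGen_one, splitAct_inl, mul_one, sub_self, zero_add]
    exact congrArg (·, _) (cocycles₂_map_one_snd φ σ).symm
  · rw [splitGen_coe φ ⟨τ, h⟩]
    simp [splitAct]

theorem split_hom_ext {V : Type} [AddCommGroup V] [Module k V]
    {f g : (C × ({σ : G // σ ≠ 1} →₀ k)) →ₗ[k] V} (h : ∀ c : C, f (c, 0) = g (c, 0))
    (h' : ∀ σ, f (splitGen φ σ) = g (splitGen φ σ)) : f = g := by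
  refine LinearMap.prod_ext (LinearMap.ext h) (Finsupp.lhom_ext' fun σ => LinearMap.ext_ring ?_)
  have := h' σ
  rwa [splitGen_coe] at this

/-- The action of `G` on the splitting module `C(φ) = C ⊕ ⨁_{σ ≠ 1} k x_σ`. -/
def splitRho : Representation k G (C × ({σ : G // σ ≠ 1} →₀ k)) where
  toFun := splitAct φ
  map_one' := by
    refine split_hom_ext φ (fun c => ?_) fun σ => ?_
    · rw [splitAct_inl, map_one]; rfl
    · have h : ((φ (1, σ) : C), (0 : {σ : G // σ ≠ 1} →₀ k)) = (φ (1, 1), 0) :=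
        congrArg (·, _) (cocycles₂_map_one_fst φ σ)
      rw [splitAct_gen, one_mul, splitGen_one, h, sub_add_cancel]
      rfl
  map_mul' σ τ := by
    refine split_hom_ext φ (fun c => ?_) fun υ => ?_
    · rw [Module.End.mul_apply, splitAct_inl, splitAct_inl, splitAct_inl, map_mul]; rfl
    · have h := (mem_cocycles₂_iff (φ : G × G → C)).1 φ.2 σ τ υ
      have h' : ((φ (σ * τ, υ) : C), (0 : {σ : G // σ ≠ 1} →₀ k)) + (φ (σ, τ), 0) =
          (C.ρ σ (φ (τ, υ)), 0) + (φ (σ, τ * υ), 0) := by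
        rw [Prod.mk_add_mk, Prod.mk_add_mk]
        exact congrArg (·, _) h
      rw [Module.End.mul_apply, splitAct_gen, splitAct_gen, map_add, map_sub, splitAct_gen,
        splitAct_gen, splitAct_inl, mul_assoc, eq_sub_of_add_eq h']
      abel

/-- The splitting module `C(φ)`. -/
def splitRep : Rep.{0, 0, 0} k G := Rep.of (splitRho φ)

/-- The linear map `C(φ) → I_G` that is zero on `C` and sends `x_σ` to `σ - 1`. -/
def splitToAugLin : (C × ({σ : G // σ ≠ 1} →₀ k)) →ₗ[k] augIdeal k G :=
  Finsupp.linearCombination k (fun σ : {σ : G // σ ≠ 1} => subOne k σ.1) ∘ₗ LinearMap.snd k _ _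

theorem splitToAugLin_inl (c : C) : splitToAugLin (c, (0 : {σ : G // σ ≠ 1} →₀ k)) = 0 := by
  simp [splitToAugLin]

theorem splitToAugLin_gen (σ : G) : splitToAugLin (splitGen φ σ) = subOne k σ := by
  by_cases h : σ = 1
  · subst h
    rw [splitGen_one, splitToAugLin_inl]
    exact Subtype.ext (sub_self _).symm
  · rw [splitGen_coe φ ⟨σ, h⟩]
    simp [splitToAugLin]

/-- The map `α : C(φ) ⟶ I_G` that is zero on `C` and sends `x_σ` to `σ - 1`. -/
def splitToAug : splitRep φ ⟶ augIdeal k G :=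
  Rep.ofHom (ρ := splitRho φ) (σ := (augIdeal k G).ρ) ⟨splitToAugLin, fun σ => by
    refine split_hom_ext φ (fun c => ?_) fun τ => ?_
    · change splitToAugLin (splitAct φ σ (c, 0)) = (augIdeal k G).ρ σ (splitToAugLin (c, 0))
      rw [splitAct_inl, splitToAugLin_inl, splitToAugLin_inl, map_zero]
    · change splitToAugLin (splitAct φ σ (splitGen φ τ)) =
        (augIdeal k G).ρ σ (splitToAugLin (splitGen φ τ))
      rw [splitAct_gen, map_add, map_sub, splitToAugLin_gen, splitToAugLin_gen,
        splitToAugLin_gen, splitToAugLin_inl, subOne_mul]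
      abel⟩

/-- The inclusion `C ⟶ C(φ)`. -/
def splitIncl : C ⟶ splitRep φ :=
  Rep.ofHom (ρ := C.ρ) (σ := splitRho φ) ⟨LinearMap.inl k C _, fun σ => by
    ext c : 1
    exact (splitAct_inl φ σ c).symm⟩

/-- The exact sequence `0 ⟶ C ⟶ C(φ) ⟶ I_G ⟶ 0`. -/
def splitSeq : ShortComplex (Rep.{0, 0, 0} k G) where
  X₁ := C
  X₂ := splitRep φ
  X₃ := augIdeal k G
  f := splitIncl φ
  g := splitToAug φ
  zero := by
    ext c : 3
    exact splitToAugLin_inl c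

theorem splitToAugLin_snd (c : C) (f : {σ : G // σ ≠ 1} →₀ k) :
    splitToAugLin (c, f) = splitToAugLin ((0 : C), f) := rfl

theorem splitToAugLin_single (σ : {σ : G // σ ≠ 1}) (r : k) :
    (splitToAugLin ((0 : C), Finsupp.single σ r)).1 =
      MonoidAlgebra.single σ.1 r - MonoidAlgebra.single 1 r := by
  have : splitToAugLin ((0 : C), Finsupp.single σ r) = r • subOne k σ.1 := by
    simp [splitToAugLin]
  rw [this]
  change r • (MonoidAlgebra.single σ.1 1 - MonoidAlgebra.single 1 1) = _
  rw [smul_sub]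
  simp

theorem splitToAugLin_add (f g : {σ : G // σ ≠ 1} →₀ k) :
    (splitToAugLin ((0 : C), f + g)).1 =
      (splitToAugLin ((0 : C), f)).1 + (splitToAugLin ((0 : C), g)).1 := by
  have : ((0 : C), f + g) = ((0 : C), f) + ((0 : C), g) := by simp
  rw [this, map_add]
  rfl

theorem splitToAugLin_zero :
    (splitToAugLin ((0 : C), (0 : {σ : G // σ ≠ 1} →₀ k))).1 = 0 :=
  congrArg Subtype.val (splitToAugLin_inl (0 : C))

theorem splitToAugLin_coeff (f : {σ : G // σ ≠ 1} →₀ k) (σ : {σ : G // σ ≠ 1}) :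
    (splitToAugLin ((0 : C), f)).1.coeff σ.1 = f σ := by
  induction f using Finsupp.induction_linear with
  | zero => rw [splitToAugLin_zero]; rfl
  | add f g hf hg =>
    rw [splitToAugLin_add, MonoidAlgebra.coeff_add, Finsupp.add_apply, Finsupp.add_apply, hf, hg]
  | single τ r =>
    classical
    rw [splitToAugLin_single, MonoidAlgebra.coeff_sub, Finsupp.sub_apply]
    change Finsupp.single τ.1 r σ.1 - Finsupp.single 1 r σ.1 = _
    rw [Finsupp.single_eq_of_ne σ.2, sub_zero, Finsupp.single_apply, Finsupp.single_apply]
    simp [Subtype.ext_iff]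

theorem splitToAugLin_subtypeDomain (x : MonoidAlgebra k G) :
    (splitToAugLin ((0 : C), x.coeff.subtypeDomain (· ≠ 1))).1 =
      x - MonoidAlgebra.single 1 ((augmentation k G).hom x) := by
  induction x using MonoidAlgebra.induction_linear with
  | zero =>
    rw [map_zero]
    refine Eq.trans ?_ (sub_eq_zero.2 (MonoidAlgebra.single_zero (1 : G)).symm).symm
    exact splitToAugLin_zero
  | add f g hf hg =>
    rw [MonoidAlgebra.coeff_add, Finsupp.subtypeDomain_add, splitToAugLin_add, hf, hg, map_add,
      MonoidAlgebra.single_add]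
    abel
  | single τ r =>
    classical
    rw [augmentation_single]
    by_cases h : τ = 1
    · subst h
      have : (MonoidAlgebra.single (1 : G) r).coeff.subtypeDomain (· ≠ 1) = 0 := by
        ext σ
        exact Finsupp.single_eq_of_ne σ.2
      rw [this, splitToAugLin_zero, sub_self]
    · have : (MonoidAlgebra.single τ r).coeff.subtypeDomain (· ≠ 1) =
          Finsupp.single ⟨τ, h⟩ r := by
        ext σ
        change Finsupp.single τ r σ.1 = _
        rw [Finsupp.single_apply, Finsupp.single_apply]
        simp [Subtype.ext_iff]
      rw [this, splitToAugLin_single]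

theorem splitSeq_shortExact : (splitSeq φ).ShortExact := by
  refine shortExact_of_apply (fun a b h => congrArg Prod.fst h) (fun x => ?_) fun x hx => ?_
  · refine ⟨((0 : C), x.1.coeff.subtypeDomain (· ≠ 1)), Subtype.ext ?_⟩
    refine (splitToAugLin_subtypeDomain x.1).trans ?_
    have hx : (augmentation k G).hom x.1 = 0 := x.2
    rw [hx]
    simp
  · obtain ⟨c, f⟩ := x
    have hf : f = 0 := by
      ext σ
      have h : splitToAugLin ((0 : C), f) = 0 := hx
      rw [← splitToAugLin_coeff (C := C) f σ, h]
      rfl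
    subst hf
    exact ⟨c, rfl⟩

end Splitting

section Fields

variable (K L : Type) [Field K] [Field L] [Algebra K L]

/-- The norm subgroup `Nm(L^×)` of `K^×`. -/
def normSubgroup : Subgroup Kˣ := (Units.map (Algebra.norm K (S := L))).range

/-- An element of `K^×`, as an element of the `Gal(L/K)`-module `L^×`. -/
def unitsIncl : Additive Kˣ →+ (Rep.ofAlgebraAutOnUnits K L : Rep ℤ Gal(L/K)) :=
  (Rep.toAdditive (M := Gal(L/K)) (G := Lˣ)).symm.toAddMonoidHom.comp
    (MonoidHom.toAdditive (Units.map (algebraMap K L).toMonoidHom))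

theorem unitsIncl_injective : Function.Injective (unitsIncl K L) :=
  fun _ _ h => Units.map_injective (f := (algebraMap K L).toMonoidHom)
    (algebraMap K L).injective h

theorem unitsIncl_mem_invariants (a : Additive Kˣ) :
    unitsIncl K L a ∈ (Rep.ofAlgebraAutOnUnits K L).ρ.invariants := fun σ =>
  congrArg (Additive.ofMul (α := Lˣ)) (Units.ext (σ.commutes a.toMul.1))

variable [FiniteDimensional K L]

/-- The homomorphism `K^× → H_T^0(Gal(L/K), L^×)` sending `a` to its class. -/
def unitsToTate : Additive Kˣ →+ tateCohomology (Rep.ofAlgebraAutOnUnits K L) 0 :=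
  AddMonoidHom.mk' (fun a => tateZeroClass _ _ (unitsIncl_mem_invariants K L a)) fun a b => by
    have h : ∀ (x : (Rep.ofAlgebraAutOnUnits K L : Rep ℤ Gal(L/K))) hx,
        x = unitsIncl K L a + unitsIncl K L b → tateZeroClass _ x hx =
        tateZeroClass _ _ (unitsIncl_mem_invariants K L a) +
        tateZeroClass _ _ (unitsIncl_mem_invariants K L b) := by
      rintro _ hx rfl
      exact tateZeroClass_add ..
    exact h _ _ (map_add _ a b)

theorem norm_unitsRep [IsGalois K L] (b : Lˣ) :
    (Rep.ofAlgebraAutOnUnits K L).ρ.norm (Additive.ofMul b) =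
      unitsIncl K L (Additive.ofMul (Units.map (Algebra.norm K (S := L)) b)) :=
  congrArg (Additive.ofMul (α := Lˣ)) (Units.ext (groupCohomology.norm_ofAlgebraAutOnUnits_eq (K := K) b))

theorem unitsToTate_eq_zero_iff [IsGalois K L] (a : Kˣ) :
    unitsToTate K L (Additive.ofMul a) = 0 ↔ a ∈ normSubgroup K L := by
  have h := tateZeroClass_eq_zero_iff _ (unitsIncl_mem_invariants K L (Additive.ofMul a))
  refine h.trans ⟨?_, ?_⟩
  · rintro ⟨b, hb⟩
    exact ⟨Additive.toMul b, Additive.ofMul.injective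
      (unitsIncl_injective K L ((norm_unitsRep K L _).symm.trans hb))⟩
  · rintro ⟨b, rfl⟩
    exact ⟨Additive.ofMul b, norm_unitsRep K L b⟩

theorem unitsToTate_surjective [IsGalois K L] : Function.Surjective (unitsToTate K L) := by
  intro y
  obtain ⟨u, hu, rfl⟩ := tateZeroClass_surjective y
  change Additive Lˣ at u
  have h (σ : Gal(L/K)) : σ u.toMul.1 = u.toMul.1 :=
    congrArg (fun v : Additive Lˣ => v.toMul.1) (hu σ)
  obtain ⟨a, ha⟩ := (IsGalois.mem_range_algebraMap_iff_fixed u.toMul.1).2 h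
  have ha0 : a ≠ 0 := by
    rintro rfl
    exact u.toMul.ne_zero (by rw [← ha, map_zero])
  have hau : unitsIncl K L (Additive.ofMul (Units.mk0 a ha0)) = u :=
    congrArg (Additive.ofMul (α := Lˣ)) (Units.ext ha)
  subst hau
  exact ⟨_, rfl⟩

/-- The isomorphism `H_T^0(Gal(L/K), L^×) ≅ K^× / Nm(L^×)`. -/
def tateZeroEquiv [IsGalois K L] : tateCohomology (Rep.ofAlgebraAutOnUnits K L) 0 ≃+
    Additive (Kˣ ⧸ normSubgroup K L) :=
  AddEquiv.symm <| MulEquiv.toAdditiveLeft <|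
    (QuotientGroup.quotientMulEquivOfEq (by
      ext a
      exact (unitsToTate_eq_zero_iff K L a).symm)).trans
    (QuotientGroup.quotientKerEquivOfSurjective (AddMonoidHom.toMultiplicativeRight (unitsToTate K L))
      (unitsToTate_surjective K L))

theorem tateZeroEquiv_unitsToTate [IsGalois K L] (a : Kˣ) :
    tateZeroEquiv K L (unitsToTate K L (Additive.ofMul a)) =
      Additive.ofMul (QuotientGroup.mk a) := by
  rw [tateZeroEquiv, AddEquiv.symm_apply_eq]
  rfl

variable {K L}

/-- For a 2-cocycle `φ` of `Gal(L/K)` in `L^×`, the composite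
`G^ab ≅ H_T^{-2}(G, ℤ) ≅ H_T^{-1}(G, I_G) → H_T^0(G, L^×) ≅ K^× / Nm(L^×)`, where the second and
third maps are the connecting homomorphisms of `0 → I_G → ℤ[G] → ℤ → 0` and
`0 → L^× → L^×(φ) → I_G → 0`. -/
def inverseReciprocity [IsGalois K L]
    (φ : groupCohomology.cocycles₂ (Rep.ofAlgebraAutOnUnits K L)) :
    Additive (Abelianization Gal(L/K)) →+ Additive (Kˣ ⧸ normSubgroup K L) :=
  let f₁ : Additive (Abelianization Gal(L/K)) →+
      tateCohomology (Rep.trivial ℤ Gal(L/K) ℤ) (-2) := (abEquivTate Gal(L/K)).toAddMonoidHom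
  let f₂ : tateCohomology (Rep.trivial ℤ Gal(L/K) ℤ) (-2) →+
      tateCohomology (augIdeal ℤ Gal(L/K)) (-1) :=
    (TateCohomology.δ augSeq_shortExact (-2)).hom.toAddMonoidHom
  let f₃ : tateCohomology (augIdeal ℤ Gal(L/K)) (-1) →+
      tateCohomology (Rep.ofAlgebraAutOnUnits K L) 0 :=
    (TateCohomology.δ (splitSeq_shortExact φ) (-1)).hom.toAddMonoidHom
  let f₄ : tateCohomology (Rep.ofAlgebraAutOnUnits K L) 0 →+ Additive (Kˣ ⧸ normSubgroup K L) :=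
    (tateZeroEquiv K L).toAddMonoidHom
  f₄.comp (f₃.comp (f₂.comp f₁))

end Fields

end

end LocalRec

namespace LocalRec

open CategoryTheory

noncomputable section

/-! ### Connecting homomorphisms from degree −1 to degree 0 -/

section Connecting

variable {k : Type} [CommRing k] {G : Type} [Group G] [Fintype G]

/-! Since `abEquivTate` is built with the inverse of the connecting isomorphism of `0 → I_G → ℤ[G] →
ℤ → 0`, applying that connecting map afterwards cancels it (`δ_augSeq_abEquivTate`). What remains is
to carry the class of `σ - 1` in `H_T^{-1}(G, I_G)` through the connecting map of the splitting
module.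

The differential of the Tate complex from degree −1 to degree 0 is the norm `∑ τ`. Hence the
connecting map `H_T^{-1} → H_T^0` lifts an element to the middle module, takes its norm there, and
pulls the result back to the submodule (`δ_tateNegOneClass`). The generator `x_σ` is a lift of `σ -
1`, and `∑ τ, τ · x_σ = ∑ τ, (x_{τσ} - x_τ + φ(τ, σ)) = ∑ τ, φ(τ, σ)`, because `τ ↦ τσ` permutes `G`
and so the `x`-terms cancel (`norm_splitGen`). Being a norm in the splitting module, this sum is
`G`-invariant (`sum_cocycle_mem_invariants`).

Written multiplicatively, the sum is the product `∏ τ, φ(τ, σ)`. As an invariant unit of `L` it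
comes from `K^×` by Galois theory, and its Tate class corresponds to its class modulo norms. -/

/-- Together with the degree 0 analogue, this lets the diagram chase for the connecting map take
place in the modules themselves instead of in the terms of the Tate complexes. -/
theorem tateIsoNegOne_inv_naturality {M N : Rep.{0, 0, 0} k G} (f : M ⟶ N) (x : M) :
    (tateComplex.map f).f (-1) ((tateIsoNegOne M).inv x) = (tateIsoNegOne N).inv (f.hom x) := by
  have h : (tateComplex.map f).f (-1) ≫ (tateIsoNegOne N).hom =
      (tateIsoNegOne M).hom ≫ f.toModuleCatHom :=
    groupHomology.chainsMap_f_0_comp_chainsIso₀ (MonoidHom.id G) f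
  have h' : (tateIsoNegOne M).inv ≫ (tateComplex.map f).f (-1) =
      f.toModuleCatHom ≫ (tateIsoNegOne N).inv := by
    rw [Iso.inv_comp_eq, ← Category.assoc, Iso.eq_comp_inv, h]
  exact congr($h' x)

theorem tateIsoZero_inv_naturality {M N : Rep.{0, 0, 0} k G} (f : M ⟶ N) (x : M) :
    (tateComplex.map f).f 0 ((tateIsoZero M).inv x) = (tateIsoZero N).inv (f.hom x) := by
  have h : (tateComplex.map f).f 0 ≫ (tateIsoZero N).hom =
      (tateIsoZero M).hom ≫ f.toModuleCatHom :=
    groupCohomology.cochainsMap_f_0_comp_cochainsIso₀ (MonoidHom.id G) f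
  have h' : (tateIsoZero M).inv ≫ (tateComplex.map f).f 0 =
      f.toModuleCatHom ≫ (tateIsoZero N).inv := by
    rw [Iso.inv_comp_eq, ← Category.assoc, Iso.eq_comp_inv, h]
  exact congr($h' x)

/-- The connecting homomorphism `H_T^{-1}(G, X₃) → H_T^0(G, X₁)` is computed by lifting an element
to `X₂` and applying the norm. -/
theorem δ_tateNegOneClass {S : ShortComplex (Rep.{0, 0, 0} k G)} (hS : S.ShortExact)
    (x : S.X₂) (a : S.X₁) (h : S.f.hom a = S.X₂.ρ.norm x)
    (hx : S.X₃.ρ.norm (S.g.hom x) = 0) (ha : a ∈ S.X₁.ρ.invariants) :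
    TateCohomology.δ hS (-1) (tateNegOneClass S.X₃ (S.g.hom x) hx) = tateZeroClass S.X₁ a ha := by
  -- The snake construction on Tate complexes: `x` in degree −1 is the chosen lift, and `a` in
  -- degree 0 has to map to the differential of `x`.
  refine (TateCohomology.map_tateComplexFunctor_shortExact hS).δ_apply (-1) 0 (by simp)
    ((tateIsoNegOne S.X₃).inv (S.g.hom x)) _ ((tateIsoNegOne S.X₂).inv x)
    (tateIsoNegOne_inv_naturality S.g x) ((tateIsoZero S.X₁).inv a) ?_ 1 (by simp)
  refine (tateIsoZero_inv_naturality S.f a).trans ?_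
  -- This differential is the norm, so the remaining goal is `h` transported along `tateIsoZero`.
  refine Eq.trans ?_ (d_inv_apply (tate_d_neg_one S.X₂) x).symm
  exact congrArg (tateIsoZero S.X₂).inv h

end Connecting

/-! ### The norm in the splitting module -/

section Splitting

variable {k : Type} [CommRing k] {G : Type} [Group G] [Fintype G]
  {C : Rep.{0, 0, 0} k G} (φ : groupCohomology.cocycles₂ C)

/-- The norm of `x_σ` in `C(φ)` is `∑ τ, φ(τ, σ)`. -/
theorem norm_splitGen (σ : G) :
    (splitRep φ).ρ.norm (splitGen φ σ) = (splitIncl φ).hom (∑ τ : G, (φ (τ, σ) : C)) := by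
  have h : ∑ τ : G, splitAct φ τ (splitGen φ σ) =
      ∑ τ : G, LinearMap.inl k C ({σ : G // σ ≠ 1} →₀ k) (φ (τ, σ)) := by
    -- The convention `x_1 = φ(1, 1)` makes the action formula valid for every index, so no separate
    -- case is needed for `σ = 1`, `τ = 1` or `τσ = 1`.
    simp only [splitAct_gen, LinearMap.inl_apply, Finset.sum_add_distrib, Finset.sum_sub_distrib]
    -- Reindexing by right multiplication turns `∑ τ, x_{τσ}` into `∑ τ, x_τ`, which cancels the
    -- subtracted sum.
    rw [Fintype.sum_equiv (Equiv.mulRight σ) (fun τ => splitGen φ (τ * σ)) (splitGen φ)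
      fun _ => rfl, sub_self, zero_add]
  rw [← map_sum] at h
  refine Eq.trans ?_ h
  exact LinearMap.sum_apply _ _ _

/-- The inclusion of `C` in `C(φ)` is injective and equivariant, so invariance may be tested in
`C(φ)`, where the sum is the norm of `x_σ` and norms are fixed by `G`. -/
theorem sum_cocycle_mem_invariants (σ : G) : ∑ τ : G, (φ (τ, σ) : C) ∈ C.ρ.invariants := by
  intro g
  apply (Rep.mono_iff_injective (splitIncl φ)).1 (splitSeq_shortExact φ).mono_f
  rw [Rep.hom_comm_apply, ← norm_splitGen]
  exact congr($((splitRep φ).ρ.self_comp_norm g) (splitGen φ σ))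

/-- The lift of `σ - 1` used for the connecting map is `x_σ`. -/
theorem δ_splitSeq_augClass (σ : G) :
    TateCohomology.δ (splitSeq_shortExact φ) (-1) (augClass (subOne k σ)) =
      tateZeroClass C (∑ τ : G, (φ (τ, σ) : C)) (sum_cocycle_mem_invariants φ σ) := by
  -- `α(x_σ) = σ - 1` is not a definitional equality; with a variable `y` for the image, `subst`
  -- replaces it together with the proof of norm zero on which its class depends.
  have h (y : augIdeal k G) (hy : splitToAugLin (splitGen φ σ) = y) :
      TateCohomology.δ (splitSeq_shortExact φ) (-1) (augClass y) =
      tateZeroClass C (∑ τ : G, (φ (τ, σ) : C)) (sum_cocycle_mem_invariants φ σ) := by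
    subst hy
    exact δ_tateNegOneClass (splitSeq_shortExact φ) (splitGen φ σ) _ (norm_splitGen φ σ).symm
      (norm_augIdeal _) _
  exact h _ (splitToAugLin_gen φ σ)

end Splitting

theorem δ_augSeq_abEquivTate {G : Type} [Group G] [Fintype G]
    (x : Additive (Abelianization G)) :
    TateCohomology.δ augSeq_shortExact (-2) (abEquivTate G x) = abToAugHom ℤ G x :=
  (tateAugIso ℤ G).toLinearEquiv.apply_symm_apply _

/-! ### From Tate classes to `K^×` modulo norms -/

section Fields

variable {K L : Type} [Field K] [Field L] [Algebra K L] [FiniteDimensional K L] [IsGalois K L]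

theorem inverseReciprocity_of
    (φ : groupCohomology.cocycles₂ (Rep.ofAlgebraAutOnUnits K L)) (σ : Gal(L/K)) :
    inverseReciprocity φ (Additive.ofMul (Abelianization.of σ)) =
      tateZeroEquiv K L (tateZeroClass _ _ (sum_cocycle_mem_invariants φ σ)) := by
  refine congrArg (tateZeroEquiv K L) ?_
  refine Eq.trans ?_ (δ_splitSeq_augClass φ σ)
  exact congrArg (TateCohomology.δ (splitSeq_shortExact φ) (-1)) (δ_augSeq_abEquivTate _)

/-- Galois descent for units: an element of `L` fixed by `Gal(L/K)` lies in `K`, and it is nonzero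
there because its image in `L` is a unit. -/
theorem exists_unitsIncl_eq (u : (Rep.ofAlgebraAutOnUnits K L : Rep ℤ Gal(L/K)))
    (hu : u ∈ (Rep.ofAlgebraAutOnUnits K L).ρ.invariants) :
    ∃ a : Kˣ, unitsIncl K L (Additive.ofMul a) = u := by
  change Additive Lˣ at u
  have h (σ : Gal(L/K)) : σ u.toMul.1 = u.toMul.1 :=
    congrArg (fun v : Additive Lˣ => v.toMul.1) (hu σ)
  obtain ⟨a, ha⟩ := (IsGalois.mem_range_algebraMap_iff_fixed u.toMul.1).2 h
  have ha0 : a ≠ 0 := by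
    rintro rfl
    exact u.toMul.ne_zero (by rw [← ha, map_zero])
  exact ⟨Units.mk0 a ha0, congrArg (Additive.ofMul (α := Lˣ)) (Units.ext ha)⟩

theorem tateZeroEquiv_tateZeroClass (a : Kˣ) (u : (Rep.ofAlgebraAutOnUnits K L : Rep ℤ Gal(L/K)))
    (hu : u ∈ (Rep.ofAlgebraAutOnUnits K L).ρ.invariants)
    (h : unitsIncl K L (Additive.ofMul a) = u) :
    tateZeroEquiv K L (tateZeroClass _ u hu) = Additive.ofMul (QuotientGroup.mk a) := by
  subst h
  exact tateZeroEquiv_unitsToTate K L a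

end Fields

end

end LocalRec

theorem mainTheorem8 (K L : Type)
    [Field K] [ValuativeRel K] [TopologicalSpace K] [IsNonarchimedeanLocalField K]
    [Field L] [Algebra K L] [FiniteDimensional K L] [IsGalois K L]
    (φ : Gal(L/K) × Gal(L/K) → Lˣ) (hφ : groupCohomology.IsMulCocycle₂ φ)
    (hgen : AddSubgroup.zmultiples
      (groupCohomology.H2π (Rep.ofAlgebraAutOnUnits K L)
        (groupCohomology.cocyclesOfIsMulCocycle₂ hφ)) = ⊤)
    (σ : Gal(L/K)) :
    ∃ a : Kˣ, algebraMap K L a = ∏ τ : Gal(L/K), (φ (τ, σ) : L) ∧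
      LocalRec.inverseReciprocity (groupCohomology.cocyclesOfIsMulCocycle₂ hφ)
          (Additive.ofMul (Abelianization.of σ)) =
        Additive.ofMul (QuotientGroup.mk a) := by
  let ψ : groupCohomology.cocycles₂ (Rep.ofAlgebraAutOnUnits K L) :=
    groupCohomology.cocyclesOfIsMulCocycle₂ hφ
  obtain ⟨a, ha⟩ := LocalRec.exists_unitsIncl_eq _ (LocalRec.sum_cocycle_mem_invariants ψ σ)
  refine ⟨a, ?_, ?_⟩
  · have h : (∑ τ : Gal(L/K), Additive.ofMul (φ (τ, σ))).toMul = ∏ τ : Gal(L/K), φ (τ, σ) :=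
      toMul_sum _ _
    have h' : Units.map (algebraMap K L).toMonoidHom a = ∏ τ : Gal(L/K), φ (τ, σ) :=
      Eq.trans (congrArg (fun v : Additive Lˣ => v.toMul) ha) h
    simpa using congrArg Units.val h'
  · exact (LocalRec.inverseReciprocity_of ψ σ).trans
      (LocalRec.tateZeroEquiv_tateZeroClass a _ _ ha)
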